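/- Let $\mathbb{R}_+=[0,\infty)$ and let $s:\mathbb{R}_+\to\mathbb{C}$ belong to $L_{2,loc}(\mathbb{R}_+)$, i.e. $s$ is square integrable on $[0,b]$ for every $b>0$ (no other assumption, in particular no sectoriality, is made). For $y\in AC_{loc}(\mathbb{R}_+)$ (absolutely continuous on every $[0,b]$) put $y^{[1]}=y'-sy$, and, when also $y^{[1]}\in AC_{loc}(\mathbb{R}_+)$, put $$l(y)=-(y^{[1]})'-s\,y^{[1]}-s^2y,$$ the regularized form of $-y''+qy$ with the distributional potential $q=s'$. Let the minimal operator $L_0$ in $L_2(\mathbb{R}_+)$ be given by $L_0y=l(y)$ on the domain $$\mathscr{D}_0=\{y\in L_2(\mathbb{R}_+):\ y,\,y^{[1]}\in AC_{loc}(\mathbb{R}_+),\ l(y)\in L_2(\mathbb{R}_+),\ y(0)=y^{[1]}(0)=0,\ \operatorname{supp}y \text{ compact}\}.$$ If $L_0$ has an extension with compact resolvent, that is, a linear operator $L\supseteq L_0$ in $L_2(\mathbb{R}_+)$ such that for some $z\in\mathbb{C}$ the inverse $(L-z)^{-1}$ exists, is defined on all of $L_2(\mathbb{R}_+)$ and is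 compact, then $$\forall a>0\qquad \lim_{x\to+\infty}\int_x^{x+a}\int_x^{x+a}|s(\xi)-s(\eta)|^2\,d\xi\,d\eta=+\infty .$$ -/

import Mathlib

open MeasureTheory Filter Set

namespace SturmLiouville

/-- The Hilbert space `L₂(ℝ₊)` of complex-valued functions, `ℝ₊ = [0, ∞)`
(the endpoint `0` is a null set). -/
abbrev L2 : Type := Lp ℂ 2 (volume.restrict (Ioi (0 : ℝ)))

/-- `s ∈ L_{2,loc}(ℝ₊)`: square integrable on every `[0, b]`. Only the values of `s` on `(0, ∞)`
matter. -/
def L2Loc (s : ℝ → ℂ) : Prop :=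
  ∀ b : ℝ, 0 < b → MemLp s 2 (volume.restrict (Ioc 0 b))

/-- `y ∈ AC_loc(ℝ₊)`: absolutely continuous on every `[0, b]`. Only the values of `y` on `[0, ∞)`
matter. -/
def ACLoc (y : ℝ → ℂ) : Prop :=
  ∀ b : ℝ, 0 < b → AbsolutelyContinuousOnInterval y 0 b

/-- `u` is the (locally absolutely continuous) quasi-derivative `y^{[1]} = y' - s y`. As `y'` and
`s` are defined almost everywhere only, so is `y' - s y`; `u` is its continuous representative. -/
def IsQuasiDeriv (s y u : ℝ → ℂ) : Prop :=
  ACLoc u ∧ ∀ᵐ x ∂volume.restrict (Ioi (0 : ℝ)), u x = deriv y x - s x * y x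

/-- The differential expression `l(y) = -(y^{[1]})' - s y^{[1]} - s² y`, with `u = y^{[1]}`. -/
noncomputable def lExpr (s y u : ℝ → ℂ) (x : ℝ) : ℂ :=
  -deriv u x - s x * u x - s x ^ 2 * y x

/-- The pair `(f, g) ∈ L₂(ℝ₊) × L₂(ℝ₊)` satisfies `f ∈ 𝒟₀` and `g = l(f)`: the class `f` has
a representative `y ∈ AC_loc(ℝ₊)` whose quasi-derivative `u = y^{[1]}` is in `AC_loc(ℝ₊)`, with
`l(y) = g ∈ L₂(ℝ₊)`, `y(0) = y^{[1]}(0) = 0`, and `y` of compact support in `[0, ∞)`. -/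
def IsMinimalPair (s : ℝ → ℂ) (f g : L2) : Prop :=
  ∃ y u : ℝ → ℂ,
    (∀ᵐ x ∂volume.restrict (Ioi (0 : ℝ)), f x = y x) ∧
    ACLoc y ∧ IsQuasiDeriv s y u ∧
    (∀ᵐ x ∂volume.restrict (Ioi (0 : ℝ)), g x = lExpr s y u x) ∧
    y 0 = 0 ∧ u 0 = 0 ∧ ∃ b : ℝ, ∀ x : ℝ, b ≤ x → y x = 0

theorem ACLoc.ae_differentiableAt {y : ℝ → ℂ} (hy : ACLoc y) :
    ∀ᵐ x ∂volume.restrict (Ioi (0 : ℝ)), DifferentiableAt ℝ y x := by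
  have h : ∀ n : ℕ, ∀ᵐ x : ℝ, x ∈ uIcc (0 : ℝ) ((n : ℝ) + 1) → DifferentiableAt ℝ y x :=
    fun n => (hy ((n : ℝ) + 1) (by positivity)).boundedVariationOn.ae_differentiableAt_of_mem_uIcc
  rw [ae_restrict_iff' measurableSet_Ioi]
  filter_upwards [ae_all_iff.2 h] with x hx hx0
  obtain ⟨n, hn⟩ := exists_nat_ge x
  refine hx n ?_
  rw [uIcc_of_le (by positivity)]
  exact ⟨le_of_lt hx0, by linarith⟩

theorem ACLoc.add {y z : ℝ → ℂ} (hy : ACLoc y) (hz : ACLoc z) : ACLoc (y + z) :=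
  fun b hb => (hy b hb).add (hz b hb)

theorem ACLoc.smul {y : ℝ → ℂ} (c : ℂ) (hy : ACLoc y) : ACLoc (c • y) :=
  fun b hb => (hy b hb).const_smul c

theorem ACLoc.zero : ACLoc 0 := fun b _ => by
  simp [AbsolutelyContinuousOnInterval, tendsto_const_nhds]

/-- A locally absolutely continuous function vanishing almost everywhere on `(0, ∞)` vanishes
everywhere there. -/
theorem ACLoc.eq_zero {y : ℝ → ℂ} (hy : ACLoc y)
    (h : ∀ᵐ x ∂volume.restrict (Ioi (0 : ℝ)), y x = 0) : ∀ x, 0 < x → y x = 0 := by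
  have hc : ContinuousOn y (Ioi 0) := by
    intro x hx
    have hx' : (0 : ℝ) < x := hx
    have h1 := (hy (x + 1) (by linarith)).continuousOn
    rw [uIcc_of_le (by linarith)] at h1
    exact (h1.continuousAt (Icc_mem_nhds hx' (by linarith))).continuousWithinAt
  exact fun x hx => Measure.eqOn_open_of_ae_eq (f := y) (g := fun _ => 0) h isOpen_Ioi hc
    continuousOn_const hx

/-- The minimal pairs form a linear subspace of `L₂(ℝ₊) × L₂(ℝ₊)`. -/
def minimalGraph (s : ℝ → ℂ) : Submodule ℂ (L2 × L2) where
  carrier := {p | IsMinimalPair s p.1 p.2}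
  zero_mem' := by
    refine ⟨0, 0, ?_, ACLoc.zero, ⟨ACLoc.zero, ?_⟩, ?_, rfl, rfl, 0, fun _ _ => rfl⟩
    · exact Lp.coeFn_zero _ _ _
    · refine Eventually.of_forall fun x => ?_
      simp
    · filter_upwards [Lp.coeFn_zero ℂ 2 (volume.restrict (Ioi (0 : ℝ)))] with x hx
      simp only [Prod.snd_zero, hx]
      simp [lExpr]
  add_mem' := by
    rintro ⟨f, g⟩ ⟨f', g'⟩ ⟨y, u, hf, hy, ⟨hu, hq⟩, hg, hy0, hu0, b, hb⟩
      ⟨y', u', hf', hy', ⟨hu', hq'⟩, hg', hy0', hu0', b', hb'⟩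
    refine ⟨y + y', u + u', ?_, hy.add hy', ⟨hu.add hu', ?_⟩, ?_, by simp [hy0, hy0'],
      by simp [hu0, hu0'], max b b', fun x hx => ?_⟩
    · filter_upwards [hf, hf', Lp.coeFn_add f f'] with x h1 h2 h3
      simp_all
    · filter_upwards [hq, hq', hy.ae_differentiableAt, hy'.ae_differentiableAt] with x h1 h2 h3 h4
      simp only [Pi.add_apply, deriv_add h3 h4, h1, h2]
      ring
    · filter_upwards [hg, hg', Lp.coeFn_add g g', hu.ae_differentiableAt, hu'.ae_differentiableAt]
        with x h1 h2 h3 h4 h5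
      simp only [Prod.mk_add_mk] at *
      simp only [h3, Pi.add_apply, h1, h2, lExpr, deriv_add h4 h5]
      ring
    · simp [hb x (le_trans (le_max_left _ _) hx), hb' x (le_trans (le_max_right _ _) hx)]
  smul_mem' := by
    rintro c ⟨f, g⟩ ⟨y, u, hf, hy, ⟨hu, hq⟩, hg, hy0, hu0, b, hb⟩
    refine ⟨c • y, c • u, ?_, hy.smul c, ⟨hu.smul c, ?_⟩, ?_, by simp [hy0], by simp [hu0], b,
      fun x hx => by simp [hb x hx]⟩
    · filter_upwards [hf, Lp.coeFn_smul c f] with x h1 h2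
      simp_all
    · filter_upwards [hq, hy.ae_differentiableAt] with x h1 h2
      simp only [Pi.smul_apply, deriv_const_smul c h2, h1, smul_eq_mul]
      ring
    · filter_upwards [hg, Lp.coeFn_smul c g, hu.ae_differentiableAt] with x h1 h2 h3
      simp only [Prod.smul_mk] at *
      simp only [h2, Pi.smul_apply, h1, lExpr, deriv_const_smul c h3, smul_eq_mul]
      ring

/-- `l(f)` depends only on the class `f`: the minimal pairs form the graph of an operator. -/
theorem minimalGraph_snd_eq_zero (s : ℝ → ℂ) (p : L2 × L2) (hp : p ∈ minimalGraph s)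
    (h0 : p.1 = 0) : p.2 = 0 := by
  obtain ⟨y, u, hf, hy, ⟨hu, hq⟩, hg, -⟩ := hp
  have hy0 : ∀ x, 0 < x → y x = 0 := by
    refine hy.eq_zero ?_
    rw [h0] at hf
    filter_upwards [hf, Lp.coeFn_zero ℂ 2 (volume.restrict (Ioi (0 : ℝ)))] with x h1 h2
    rw [← h1, h2]; rfl
  have hd : ∀ {v : ℝ → ℂ}, (∀ x, 0 < x → v x = 0) → ∀ x, 0 < x → deriv v x = 0 := by
    intro v hv x hx
    have : v =ᶠ[nhds x] fun _ => 0 := by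
      filter_upwards [Ioi_mem_nhds hx] with t ht using hv t ht
    rw [this.deriv_eq]; simp
  have hu0 : ∀ x, 0 < x → u x = 0 := by
    refine hu.eq_zero ?_
    filter_upwards [hq, ae_restrict_mem measurableSet_Ioi] with x h1 h2
    rw [h1, hd hy0 x h2, hy0 x h2]; simp
  refine (Lp.eq_zero_iff_ae_eq_zero).2 ?_
  filter_upwards [hg, ae_restrict_mem measurableSet_Ioi] with x h1 h2
  rw [h1, lExpr, hd hu0 x h2, hu0 x h2, hy0 x h2]; simp

/-- The minimal operator `L₀ f = l(f)`, `f ∈ 𝒟₀`, in `L₂(ℝ₊)`. -/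
noncomputable def minimalOperator (s : ℝ → ℂ) : L2 →ₗ.[ℂ] L2 :=
  (minimalGraph s).toLinearPMap

/-- The graph of `L₀` consists exactly of the pairs `(f, l(f))`, `f ∈ 𝒟₀`. -/
theorem mem_graph_minimalOperator (s : ℝ → ℂ) (f g : L2) :
    (f, g) ∈ (minimalOperator s).graph ↔ IsMinimalPair s f g := by
  rw [minimalOperator, Submodule.toLinearPMap_graph_eq _ (minimalGraph_snd_eq_zero s)]
  rfl

/-- The bounded operator `R`, defined on the whole space, is the resolvent `(A - z)⁻¹` of `A`
at `z`. -/
def IsResolventAt (A : L2 →ₗ.[ℂ] L2) (z : ℂ) (R : L2 →L[ℂ] L2) : Prop :=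
  (∀ f : L2, ∃ x : A.domain, (x : L2) = R f ∧ A x - z • (x : L2) = f) ∧
    ∀ x : A.domain, R (A x - z • (x : L2)) = x

/-- `A` has compact resolvent: `(A - z)⁻¹` exists as a bounded everywhere defined operator and is
compact for some `z` (then it is compact for every `z` in the resolvent set). -/
def HasCompactResolvent (A : L2 →ₗ.[ℂ] L2) : Prop :=
  ∃ (z : ℂ) (R : L2 →L[ℂ] L2), IsResolventAt A z R ∧ IsCompactOperator R

end SturmLiouville

namespace SturmLiouville

/-! If the limit fails, arbitrarily distant windows of length `a` have oscillation below some `B`.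
On such a window `s` is `L₂`-close to a constant `c`, and by pigeonhole it contains an interval of
length `δ`, depending on `a` and `B` only, where `1 + |s - c| + |s - c|²` has integral at most `1/4`
(`exists_subinterval`).

Replacing `s` by `s - c` does not change `q = s'`, so on that interval `l(φ) = 0` has a solution `φ`
close to `1` (`exists_system_solution`). A bare cutoff `ψ` need not lie in the domain, as `sψ` need
not be continuous, but `ψφ` does, and `l(ψφ) = -(ψ''φ + 2ψ'φ')` is bounded in `L₂` in terms of `δ`
only (`exists_minimalPair`).

This gives disjointly supported `fₙ ∈ 𝒟₀`, bounded below in norm, with `(L - z)fₙ` bounded. The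
resolvent maps the latter to the orthogonal, hence uniformly separated, `fₙ`, so it is not compact.
-/

/-! ### Absolute continuity and Volterra systems -/

theorem absolutelyContinuousOnInterval_of_dist_le {X Y : Type*} [PseudoMetricSpace X]
    [PseudoMetricSpace Y] {f : ℝ → X} {g : ℝ → Y} {a b : ℝ}
    (hg : AbsolutelyContinuousOnInterval g a b) (h : ∀ x y, dist (f x) (f y) ≤ dist (g x) (g y)) :
    AbsolutelyContinuousOnInterval f a b :=
  squeeze_zero (fun _ => Finset.sum_nonneg fun _ _ => dist_nonneg)
    (fun _ => Finset.sum_le_sum fun _ _ => h _ _) hg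

/-- The primitive of an integrable vector-valued function is absolutely continuous. -/
theorem absolutelyContinuousOnInterval_primitive {E : Type*} [NormedAddCommGroup E]
    [NormedSpace ℝ E] {f : ℝ → E} (hf : Integrable f) (c a b : ℝ) :
    AbsolutelyContinuousOnInterval (fun x => ∫ t in c..x, f t) a b := by
  have hi : ∀ x y : ℝ, IntervalIntegrable f volume x y := fun x y => hf.intervalIntegrable
  have hn : ∀ x y : ℝ, IntervalIntegrable (fun t => ‖f t‖) volume x y :=
    fun x y => hf.norm.intervalIntegrable
  have key : AbsolutelyContinuousOnInterval (fun x => ∫ t in a..x, ‖f t‖) a b :=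
    (hn a b).absolutelyContinuousOnInterval_intervalIntegral left_mem_uIcc
  refine absolutelyContinuousOnInterval_of_dist_le key fun x y => ?_
  rw [dist_eq_norm, dist_eq_norm, intervalIntegral.integral_interval_sub_left (hi _ _) (hi _ _),
    intervalIntegral.integral_interval_sub_left (hn _ _) (hn _ _), Real.norm_eq_abs]
  exact intervalIntegral.norm_integral_le_abs_integral_norm

open BoundedContinuousFunction in
/-- Solvability of a Volterra equation whose right-hand side is Lipschitz with an integrable
constant of small integral. -/
theorem exists_integral_equation_solution {E : Type*} [NormedAddCommGroup E] [NormedSpace ℝ E]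
    [CompleteSpace E] {F : ℝ → E → E} {k : ℝ → ℝ} (hk : Integrable k) (hk0 : ∀ t, 0 ≤ k t)
    (hk4 : ∫ t, k t ≤ 1 / 4) (hF : ∀ t z w, ‖F t z - F t w‖ ≤ k t * ‖z - w‖)
    (hF0 : ∀ t, F t 0 = 0)
    (hm : ∀ z : ℝ → E, Continuous z → AEStronglyMeasurable (fun t => F t (z t)) volume)
    (α : ℝ) (z₀ : E) :
    ∃ z : ℝ → E, Continuous z ∧ Integrable (fun t => F t (z t)) ∧
      (∀ x, z x = z₀ + ∫ t in α..x, F t (z t)) ∧ ∀ x, ‖z x - z₀‖ ≤ ‖z₀‖ / 3 := by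
  have hint : ∀ z : ℝ →ᵇ E, Integrable (fun t => F t (z t)) := by
    intro z
    refine (hk.mul_const ‖z‖).mono' (hm z z.continuous) (Eventually.of_forall fun t => ?_)
    calc ‖F t (z t)‖ = ‖F t (z t) - F t 0‖ := by rw [hF0, sub_zero]
      _ ≤ k t * ‖z t - 0‖ := hF _ _ _
      _ ≤ k t * ‖z‖ := by
        rw [sub_zero]; exact mul_le_mul_of_nonneg_left (z.norm_coe_le_norm t) (hk0 t)
  have hbound : ∀ (f : ℝ → E) (C : ℝ), (∀ t, ‖f t‖ ≤ k t * C) → 0 ≤ C → ∀ x,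
      ‖∫ t in α..x, f t‖ ≤ 1 / 4 * C := by
    intro f C hf hC x
    calc ‖∫ t in α..x, f t‖ ≤ ∫ t in uIoc α x, ‖f t‖ :=
          intervalIntegral.norm_integral_le_integral_norm_uIoc
      _ ≤ ∫ t in uIoc α x, k t * C :=
          integral_mono_of_nonneg (Eventually.of_forall fun t => norm_nonneg _)
            (hk.mul_const C).integrableOn (Eventually.of_forall hf)
      _ ≤ ∫ t, k t * C := setIntegral_le_integral (hk.mul_const C)
            (Eventually.of_forall fun t => mul_nonneg (hk0 t) hC)
      _ = (∫ t, k t) * C := integral_mul_const _ _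
      _ ≤ 1 / 4 * C := by gcongr
  have hFn : ∀ (z : ℝ →ᵇ E) t, ‖F t (z t)‖ ≤ k t * ‖z‖ := by
    intro z t
    calc ‖F t (z t)‖ = ‖F t (z t) - F t 0‖ := by rw [hF0, sub_zero]
      _ ≤ k t * ‖z t - 0‖ := hF _ _ _
      _ ≤ k t * ‖z‖ := by
        rw [sub_zero]; exact mul_le_mul_of_nonneg_left (z.norm_coe_le_norm t) (hk0 t)
  -- Picard map on all of `ℝ`: since `k` has total integral at most `1/4`, it contracts by `1/4` in
  -- the plain sup norm.
  let T : (ℝ →ᵇ E) → (ℝ →ᵇ E) := fun z =>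
    BoundedContinuousFunction.ofNormedAddCommGroup (fun x => z₀ + ∫ t in α..x, F t (z t))
      (continuous_const.add (intervalIntegral.continuous_primitive
        (fun a b => (hint z).intervalIntegrable) α)) (‖z₀‖ + 1 / 4 * ‖z‖) (fun x =>
        (norm_add_le _ _).trans (add_le_add_right (hbound _ _ (hFn z) (norm_nonneg _) x) _))
  have hTz : ∀ z x, T z x = z₀ + ∫ t in α..x, F t (z t) := fun z x => rfl
  have hT : ContractingWith (1 / 4) T := by
    refine ⟨?_, LipschitzWith.of_dist_le_mul fun z w => ?_⟩
    · rw [← NNReal.coe_lt_coe]; norm_num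
    · rw [BoundedContinuousFunction.dist_le (by positivity)]
      intro x
      have h1 := hbound (fun t => F t (z t) - F t (w t)) (dist z w) (fun t =>
        (hF _ _ _).trans (mul_le_mul_of_nonneg_left
          (by rw [← dist_eq_norm]; exact z.dist_coe_le_dist t) (hk0 t))) dist_nonneg x
      rw [intervalIntegral.integral_sub (hint z).intervalIntegrable
        (hint w).intervalIntegrable] at h1
      rw [hTz, hTz, dist_add_left, dist_eq_norm]
      simpa using h1
  have hfix : T (hT.fixedPoint T) = hT.fixedPoint T := hT.fixedPoint_isFixedPt
  set z := hT.fixedPoint T with hz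
  have heq : ∀ x, z x = z₀ + ∫ t in α..x, F t (z t) := fun x => by
    conv_lhs => rw [← hfix]
    exact hTz z x
  have hd : ∀ x, ‖z x - z₀‖ ≤ 1 / 4 * ‖z‖ := fun x => by
    have := hbound _ _ (hFn z) (norm_nonneg _) x
    rwa [heq x, add_sub_cancel_left]
  -- Absorbing the last term gives `‖z‖ ≤ 4/3 ‖z₀‖`, hence the deviation `‖z₀‖ / 3`.
  have hzn : ‖z‖ ≤ ‖z₀‖ + 1 / 4 * ‖z‖ := by
    rw [BoundedContinuousFunction.norm_le (by positivity)]
    intro x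
    calc ‖z x‖ = ‖z₀ + (z x - z₀)‖ := by rw [add_sub_cancel]
      _ ≤ ‖z₀‖ + 1 / 4 * ‖z‖ := (norm_add_le _ _).trans (add_le_add_right (hd x) _)
  exact ⟨z, z.continuous, hint z, heq, fun x => (hd x).trans (by linarith)⟩

/-- If `e`, `p`, `p²` have small integrals, the system `φ' = p φ + e v`, `v' = -p² φ - p v` has
an absolutely continuous solution with `φ` close to `1` and `v` close to `0`. -/
theorem exists_system_solution {e p : ℝ → ℂ} (he : AEStronglyMeasurable e volume)
    (hp : AEStronglyMeasurable p volume)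
    (hk : Integrable fun t => ‖e t‖ + ‖p t‖ + ‖p t‖ ^ 2)
    (hk4 : ∫ t, (‖e t‖ + ‖p t‖ + ‖p t‖ ^ 2) ≤ 1 / 4) :
    ∃ φ v : ℝ → ℂ, Continuous φ ∧ Continuous v ∧
      (∀ a b, AbsolutelyContinuousOnInterval φ a b) ∧
      (∀ a b, AbsolutelyContinuousOnInterval v a b) ∧
      (∀ x, ‖φ x - 1‖ ≤ 1 / 3) ∧ (∀ x, ‖v x‖ ≤ 1 / 3) ∧
      ∀ᵐ x, HasDerivAt φ (p x * φ x + e x * v x) x ∧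
        HasDerivAt v (-(p x ^ 2 * φ x) - p x * v x) x := by
  let F : ℝ → ℂ × ℂ → ℂ × ℂ := fun t z =>
    (p t * z.1 + e t * z.2, -(p t ^ 2 * z.1) - p t * z.2)
  have hFsub : ∀ t z w, F t z - F t w = F t (z - w) := by
    intro t z w
    ext <;> simp [F] <;> ring
  have hFn : ∀ t z, ‖F t z‖ ≤ (‖e t‖ + ‖p t‖ + ‖p t‖ ^ 2) * ‖z‖ := by
    intro t z
    have h1 := norm_fst_le z
    have h2 := norm_snd_le z
    have he0 := norm_nonneg (e t)
    have hp0 := norm_nonneg (p t)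
    refine norm_prod_le_iff.2 ⟨?_, ?_⟩
    · calc ‖p t * z.1 + e t * z.2‖ ≤ ‖p t‖ * ‖z.1‖ + ‖e t‖ * ‖z.2‖ := by
            simpa using norm_add_le (p t * z.1) (e t * z.2)
        _ ≤ ‖p t‖ * ‖z‖ + ‖e t‖ * ‖z‖ := by gcongr
        _ ≤ _ := by nlinarith [norm_nonneg z, mul_nonneg (sq_nonneg ‖p t‖) (norm_nonneg z)]
    · calc ‖-(p t ^ 2 * z.1) - p t * z.2‖ ≤ ‖p t‖ ^ 2 * ‖z.1‖ + ‖p t‖ * ‖z.2‖ := 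
            (norm_sub_le _ _).trans_eq (by rw [norm_neg, norm_mul, norm_pow, norm_mul])
        _ ≤ ‖p t‖ ^ 2 * ‖z‖ + ‖p t‖ * ‖z‖ := by gcongr
        _ ≤ _ := by nlinarith [norm_nonneg z, mul_nonneg he0 (norm_nonneg z)]
  obtain ⟨z, hzc, hzi, hz, hzn⟩ := exists_integral_equation_solution (F := F) hk
    (fun t => by positivity) hk4 (fun t z w => by rw [hFsub]; exact hFn t _)
    (fun t => by simp [F])
    (fun z hz => ((hp.mul hz.fst.aestronglyMeasurable).add
      (he.mul hz.snd.aestronglyMeasurable)).prodMk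
      (((hp.pow 2).mul hz.fst.aestronglyMeasurable).neg.sub
        (hp.mul hz.snd.aestronglyMeasurable))) 0 (1, 0)
  have hz0 : ‖((1 : ℂ), (0 : ℂ))‖ = 1 := by simp [Prod.norm_def]
  have hac : ∀ a b, AbsolutelyContinuousOnInterval z a b := fun a b =>
    absolutelyContinuousOnInterval_of_dist_le
      (absolutelyContinuousOnInterval_primitive hzi 0 a b) fun x y => by
        rw [hz x, hz y, dist_add_left]
  refine ⟨fun x => (z x).1, fun x => (z x).2, hzc.fst, hzc.snd, fun a b =>
    absolutelyContinuousOnInterval_of_dist_le (hac a b) fun x y => ?_, fun a b =>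
    absolutelyContinuousOnInterval_of_dist_le (hac a b) fun x y => ?_, fun x => ?_, fun x => ?_, ?_⟩
  · rw [Prod.dist_eq]; exact le_max_left _ _
  · rw [Prod.dist_eq]; exact le_max_right _ _
  · have := (norm_fst_le _).trans (hzn x)
    simpa [hz0] using this
  · have := (norm_snd_le _).trans (hzn x)
    simpa [hz0] using this
  · filter_upwards [LocallyIntegrable.ae_hasDerivAt_integral hzi.locallyIntegrable] with x hx
    have h1 : HasDerivAt z (F x (z x)) x := by
      have := (hx 0).const_add ((1, 0) : ℂ × ℂ)
      rwa [← funext hz] at this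
    exact ⟨h1.fst, h1.snd⟩

/-! ### Test functions in the minimal domain -/

/-- A smooth cutoff on `(0, δ)` together with its first two derivatives. -/
theorem exists_cutoff {δ : ℝ} (hδ : 0 < δ) :
    ∃ (ψ ψ₁ ψ₂ : ℝ → ℂ) (D : ℝ), ContDiff ℝ 1 ψ ∧ ContDiff ℝ 1 ψ₁ ∧ Continuous ψ₂ ∧
      (∀ x, HasDerivAt ψ (ψ₁ x) x) ∧ (∀ x, HasDerivAt ψ₁ (ψ₂ x) x) ∧
      (∀ x, x ∉ Ioo 0 δ → ψ x = 0 ∧ ψ₁ x = 0 ∧ ψ₂ x = 0) ∧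
      (∀ x, ‖ψ x‖ ≤ 1) ∧ (∀ x, ‖ψ₁ x‖ ≤ D) ∧ (∀ x, ‖ψ₂ x‖ ≤ D) ∧
      ∀ x ∈ Icc (δ / 4) (3 * δ / 4), ψ x = 1 := by
  -- Inner radius `δ/4` gives `1` on the middle half; outer radius `δ/3 < δ/2` keeps the closed
  -- support inside `(0, δ)`.
  let b : ContDiffBump (δ / 2) := ⟨δ / 4, δ / 3, by linarith, by linarith⟩
  let ψ : ℝ → ℂ := fun x => ((b x : ℝ) : ℂ)
  have hψ : ContDiff ℝ 2 ψ := Complex.ofRealCLM.contDiff.comp b.contDiff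
  have hψ₁ : ContDiff ℝ 1 (deriv ψ) :=
    (contDiff_succ_iff_deriv.1 (hψ : ContDiff ℝ (1 + 1) ψ)).2.2
  have hts : tsupport ψ ⊆ Ioo 0 δ := by
    have h1 : tsupport ψ ⊆ tsupport b :=
      closure_mono fun x hx => by
        simp only [Function.mem_support] at hx ⊢
        intro h
        exact hx (by simp [ψ, h])
    refine h1.trans ?_
    rw [b.tsupport_eq, Real.closedBall_eq_Icc]
    intro x hx
    simp only [b, mem_Icc] at hx
    constructor <;> linarith [hx.1, hx.2]
  have hc : HasCompactSupport ψ :=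
    HasCompactSupport.comp_left (g := fun r : ℝ => (r : ℂ)) b.hasCompactSupport (by simp)
  have hψ₂ : Continuous (deriv (deriv ψ)) := hψ₁.continuous_deriv le_rfl
  obtain ⟨D₁, hD₁⟩ := hc.deriv.exists_bound_of_continuous hψ₁.continuous
  obtain ⟨D₂, hD₂⟩ := hc.deriv.deriv.exists_bound_of_continuous hψ₂
  refine ⟨ψ, deriv ψ, deriv (deriv ψ), max D₁ D₂, hψ.of_le (by norm_num), hψ₁, hψ₂,
    fun x => (hψ.differentiable (by norm_num) x).hasDerivAt,
    fun x => (hψ₁.differentiable (by norm_num) x).hasDerivAt, fun x hx => ?_, fun x => ?_,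
    fun x => (hD₁ x).trans (le_max_left _ _), fun x => (hD₂ x).trans (le_max_right _ _),
    fun x hx => ?_⟩
  · have h0 : x ∉ tsupport ψ := fun h => hx (hts h)
    have h1 : x ∉ tsupport (deriv ψ) := fun h => h0 (tsupport_deriv_subset h)
    have h2 : x ∉ tsupport (deriv (deriv ψ)) := fun h => h1 (tsupport_deriv_subset h)
    exact ⟨image_eq_zero_of_notMem_tsupport h0, image_eq_zero_of_notMem_tsupport h1,
      image_eq_zero_of_notMem_tsupport h2⟩
  · simp only [ψ, Complex.norm_real, Real.norm_eq_abs, abs_of_nonneg b.nonneg]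
    exact b.le_one
  · have : b x = 1 := b.one_of_mem_closedBall (by
      rw [Real.closedBall_eq_Icc]
      simp only [b]
      constructor <;> linarith [hx.1, hx.2])
    simp [ψ, this]

theorem L2.norm_sq_toLp {h : ℝ → ℂ} (hh : MemLp h 2 (volume.restrict (Ioi (0 : ℝ)))) :
    ‖hh.toLp h‖ ^ 2 = ∫ x in Ioi (0 : ℝ), ‖h x‖ ^ 2 := by
  rw [← inner_self_eq_norm_sq (𝕜 := ℂ), MeasureTheory.L2.inner_def, ← integral_re]
  · refine integral_congr_ae ?_
    filter_upwards [hh.coeFn_toLp] with x hx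
    rw [hx, inner_self_eq_norm_sq]
  · exact MeasureTheory.L2.integrable_inner _ _

/-- On an interval of length `δ` on which `s` is `L₂`-close to a constant there is a
function of the domain of the minimal operator, not small in norm, on which that operator is
bounded, with bounds depending on `δ` only. -/
theorem exists_minimalPair {δ : ℝ} (hδ : 0 < δ) :
    ∃ C : ℝ, ∀ (s : ℝ → ℂ) (α : ℝ) (c : ℂ), L2Loc s → 0 ≤ α →
      ∫ t in α..α + δ, (1 + ‖s t - c‖ + ‖s t - c‖ ^ 2) ≤ 1 / 4 →
      ∃ f g : L2, IsMinimalPair s f g ∧ 2 * δ / 9 ≤ ‖f‖ ^ 2 ∧ ‖f‖ ≤ 1 ∧ ‖g‖ ≤ C ∧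
        ∀ᵐ x ∂volume.restrict (Ioi (0 : ℝ)), x ∉ Ioc α (α + δ) → f x = 0 := by
  obtain ⟨ψ, ψ₁, ψ₂, D, hψ, hψ₁, hψ₂, hd, hd₁, hsupp, hψb, hψ₁b, hψ₂b, hone⟩ := exists_cutoff hδ
  have hD : 0 ≤ D := (norm_nonneg _).trans (hψ₁b 0)
  refine ⟨3 * D, fun s α c hs hα hk4 => ?_⟩
  set S := Ioc α (α + δ) with hS
  -- Truncating the coefficients to `S` puts the system on all of `ℝ` with small integrals; outside
  -- `S` the cutoff kills everything.
  set e : ℝ → ℂ := S.indicator 1 with he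
  set p : ℝ → ℂ := S.indicator (fun t => s t - c) with hp
  have hSm : MeasurableSet S := measurableSet_Ioc
  have he1 : ∀ x ∈ S, e x = 1 := fun x hx => by simp [he, hx]
  have he0 : ∀ x ∉ S, e x = 0 := fun x hx => by simp [he, hx]
  have hp1 : ∀ x ∈ S, p x = s x - c := fun x hx => by simp [hp, hx]
  have hp0 : ∀ x ∉ S, p x = 0 := fun x hx => by simp [hp, hx]
  have heL : MemLp e 2 volume := by
    rw [he, memLp_indicator_iff_restrict hSm]
    exact memLp_const (1 : ℂ)
  have hpL : MemLp p 2 volume := by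
    rw [hp, memLp_indicator_iff_restrict hSm]
    refine ((hs (α + δ) (by linarith)).mono_measure ?_).sub (memLp_const c)
    exact Measure.restrict_mono (Ioc_subset_Ioc_left hα) le_rfl
  have heI : Integrable e := by
    rw [he, integrable_indicator_iff hSm]
    exact integrableOn_const (C := (1 : ℂ))
      (by simp [hS])
  have hpI : Integrable p := by
    have h1 : Integrable p (volume.restrict S) :=
      (hpL.mono_measure Measure.restrict_le_self).integrable (by norm_num)
    refine (integrableOn_iff_integrable_of_support_subset (s := S) ?_).1 h1
    exact support_indicator_subset
  have hp2 : Integrable fun t => ‖p t‖ ^ 2 := hpL.integrable_norm_pow two_ne_zero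
  set k : ℝ → ℝ := fun t => ‖e t‖ + ‖p t‖ + ‖p t‖ ^ 2 with hkdef
  have hk0 : ∀ t, 0 ≤ k t := fun t => by positivity
  have hkI : Integrable k := (heI.norm.add hpI.norm).add hp2
  have hkint : ∫ t, k t ≤ 1 / 4 := by
    have : k = S.indicator fun t => 1 + ‖s t - c‖ + ‖s t - c‖ ^ 2 := by
      ext t
      by_cases ht : t ∈ S
      · simp [hkdef, he1 t ht, hp1 t ht, ht]
      · simp [hkdef, he0 t ht, hp0 t ht, ht]
    rw [this, integral_indicator hSm, hS, ← intervalIntegral.integral_of_le (by linarith)]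
    exact hk4
  obtain ⟨φ, v, hφc, hvc, hφac, hvac, hφ, hv, hder⟩ :=
    exists_system_solution heL.1 hpL.1 hkI hkint
  have hφle : ∀ x, ‖φ x‖ ≤ 4 / 3 := fun x => by
    calc ‖φ x‖ = ‖1 + (φ x - 1)‖ := by rw [add_sub_cancel]
      _ ≤ ‖(1 : ℂ)‖ + ‖φ x - 1‖ := norm_add_le _ _
      _ ≤ 1 + 1 / 3 := by rw [norm_one]; gcongr; exact hφ x
      _ = 4 / 3 := by norm_num
  have hφge : ∀ x, 2 / 3 ≤ ‖φ x‖ := fun x => by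
    have h1 : ‖(1 : ℂ)‖ - ‖1 - φ x‖ ≤ ‖φ x‖ := by
      simpa using norm_sub_norm_le (1 : ℂ) (1 - φ x)
    rw [norm_one, norm_sub_rev] at h1
    linarith [hφ x]
  have hzero : ∀ x ∉ S, ψ (x - α) = 0 ∧ ψ₁ (x - α) = 0 ∧ ψ₂ (x - α) = 0 := fun x hx =>
    hsupp _ fun h => hx ⟨by linarith [h.1], by linarith [h.2]⟩
  have hχ : ∀ x, HasDerivAt (fun t => ψ (t - α)) (ψ₁ (x - α)) x := fun x =>
    (hd (x - α)).comp_sub_const x α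
  have hχ₁ : ∀ x, HasDerivAt (fun t => ψ₁ (t - α)) (ψ₂ (x - α)) x := fun x =>
    (hd₁ (x - α)).comp_sub_const x α
  have hcs : ContDiff ℝ 1 fun t : ℝ => t - α := contDiff_id.sub contDiff_const
  have hχac : ∀ a b, AbsolutelyContinuousOnInterval (fun t => ψ (t - α)) a b := fun a b =>
    (hψ.comp hcs).contDiffOn.absolutelyContinuousOnInterval
  have hχ₁ac : ∀ a b, AbsolutelyContinuousOnInterval (fun t => ψ₁ (t - α)) a b := fun a b =>
    (hψ₁.comp hcs).contDiffOn.absolutelyContinuousOnInterval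
  set y : ℝ → ℂ := fun x => ψ (x - α) * φ x with hy
  -- On `S`, `v = φ' - (s - c)φ`, so `φ' - sφ = v - cφ`.
  set u : ℝ → ℂ := fun x => ψ₁ (x - α) * φ x + ψ (x - α) * (v x - c * φ x) with hu
  -- As `l(φ) = 0` on `S`, only the commutator with the cutoff survives; `c` enters only through `p
  -- = s - c`.
  set G : ℝ → ℂ := fun x => -(ψ₂ (x - α) * φ x + 2 * ψ₁ (x - α) * (p x * φ x + e x * v x)) with hG
  have hyle : ∀ x, ‖y x‖ ≤ 4 / 3 * ‖e x‖ := fun x => by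
    by_cases hx : x ∈ S
    · rw [he1 x hx, norm_one, mul_one, hy, norm_mul]
      nlinarith [hψb (x - α), hφle x, norm_nonneg (φ x), norm_nonneg (ψ (x - α))]
    · simp [hy, (hzero x hx).1, he0 x hx]
  have hGle : ∀ x, ‖G x‖ ≤ 4 * D * (‖e x‖ + ‖p x‖) := fun x => by
    by_cases hx : x ∈ S
    · rw [he1 x hx, norm_one, hG]
      simp only [norm_neg, he1 x hx, one_mul]
      calc _ ≤ ‖ψ₂ (x - α) * φ x‖ + ‖2 * ψ₁ (x - α) * (p x * φ x + v x)‖ := norm_add_le _ _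
        _ ≤ ‖ψ₂ (x - α)‖ * ‖φ x‖ + 2 * ‖ψ₁ (x - α)‖ * (‖p x‖ * ‖φ x‖ + ‖v x‖) := by
          rw [norm_mul, norm_mul, norm_mul, Complex.norm_ofNat, ← norm_mul (p x)]
          gcongr
          exact norm_add_le _ _
        _ ≤ D * (4 / 3) + 2 * D * (‖p x‖ * (4 / 3) + 1 / 3) := by
          gcongr
          exacts [hψ₂b _, hφle x, hψ₁b _, hφle x, hv x]
        _ ≤ 4 * D * (1 + ‖p x‖) := by nlinarith [mul_nonneg hD (norm_nonneg (p x))]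
    · simp [hG, hzero x hx, he0 x hx, hp0 x hx]
  have hyL : MemLp y 2 volume := by
    refine (heL.norm.const_mul (4 / 3)).mono ?_ (Eventually.of_forall fun x => ?_)
    · exact ((hψ.continuous.comp hcs.continuous).mul hφc).aestronglyMeasurable
    · exact (hyle x).trans (le_abs_self _)
  have hGL : MemLp G 2 volume := by
    refine ((heL.norm.add hpL.norm).const_mul (4 * D)).mono ?_ (Eventually.of_forall fun x => ?_)
    · exact (((hψ₂.comp hcs.continuous).aestronglyMeasurable.mul hφc.aestronglyMeasurable).add
        (((hψ₁.continuous.comp hcs.continuous).aestronglyMeasurable.const_mul 2).mul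
          ((hpL.1.mul hφc.aestronglyMeasurable).add (heL.1.mul hvc.aestronglyMeasurable)))).neg
    · exact (hGle x).trans (le_abs_self _)
  have hyR := hyL.mono_measure (Measure.restrict_le_self (s := Ioi (0 : ℝ)))
  have hGR := hGL.mono_measure (Measure.restrict_le_self (s := Ioi (0 : ℝ)))
  have hupper : ∀ (h : ℝ → ℂ) (K : ℝ), 0 ≤ K → (∀ x, ‖h x‖ ^ 2 ≤ K * k x) →
      ∫ x in Ioi (0 : ℝ), ‖h x‖ ^ 2 ≤ K / 4 := fun h K hK hle =>
    calc ∫ x in Ioi (0 : ℝ), ‖h x‖ ^ 2 ≤ ∫ x in Ioi (0 : ℝ), K * k x :=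
          integral_mono_of_nonneg (Eventually.of_forall fun t => by positivity)
            (hkI.const_mul K).integrableOn (Eventually.of_forall hle)
      _ ≤ ∫ x, K * k x := setIntegral_le_integral (hkI.const_mul K)
            (Eventually.of_forall fun t => mul_nonneg hK (hk0 t))
      _ = K * ∫ x, k x := integral_const_mul _ _
      _ ≤ K * (1 / 4) := by gcongr
      _ = K / 4 := by ring
  refine ⟨hyR.toLp y, hGR.toLp G, ⟨y, u, hyR.coeFn_toLp, ?_, ⟨?_, ?_⟩, ?_, ?_, ?_, α + δ, ?_⟩,
    ?_, ?_, ?_, ?_⟩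
  · exact fun b _ => (hχac 0 b).fun_smul (hφac 0 b)
  · exact fun b _ => ((hχ₁ac 0 b).fun_smul (hφac 0 b)).add
      ((hχac 0 b).fun_smul ((hvac 0 b).sub ((hφac 0 b).const_smul c)))
  · refine ae_restrict_of_ae ?_
    filter_upwards [hder] with x hx
    have hdy : deriv y x = _ := ((hχ x).mul hx.1).deriv
    rw [hdy]
    by_cases hxS : x ∈ S
    · simp only [hu, he1 x hxS, hp1 x hxS, hy]
      ring
    · simp [hu, hy, hzero x hxS]
  · filter_upwards [hGR.coeFn_toLp, ae_restrict_of_ae hder] with x hGx hx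
    have hdu := ((hχ₁ x).mul hx.1).add ((hχ x).mul (hx.2.sub (hx.1.const_mul c)))
    have hdu' : deriv u x = _ := hdu.deriv
    rw [hGx, lExpr, hdu']
    by_cases hxS : x ∈ S
    · simp only [hG, hu, he1 x hxS, hp1 x hxS, hy, Pi.sub_apply]
      ring
    · simp [hG, hu, hy, hzero x hxS]
  · have := (hzero 0 fun h => absurd h.1 (by linarith)).1
    simp only [hy, this, zero_mul]
  · have := hzero 0 fun h => absurd h.1 (by linarith)
    simp only [hu, this, zero_mul, add_zero]
  · intro x hx
    have := (hsupp (x - α) fun h => by linarith [h.2]).1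
    simp only [hy, this, zero_mul]
  · rw [L2.norm_sq_toLp]
    have hsub : Icc (α + δ / 4) (α + 3 * δ / 4) ⊆ Ioi 0 := fun x hx => by
      have := hx.1
      simp only [mem_Ioi]
      linarith
    -- On the middle half, of length `δ/2`, `y = φ` and `|φ| ≥ 2/3`.
    calc 2 * δ / 9 = ∫ x in Icc (α + δ / 4) (α + 3 * δ / 4), (4 / 9 : ℝ) := by
          rw [setIntegral_const, measureReal_def, Real.volume_Icc, ENNReal.toReal_ofReal
            (by linarith), smul_eq_mul]
          ring
      _ ≤ ∫ x in Icc (α + δ / 4) (α + 3 * δ / 4), ‖y x‖ ^ 2 := by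
          refine setIntegral_mono_on (integrableOn_const (by simp))
            (hyL.integrable_norm_pow two_ne_zero).integrableOn measurableSet_Icc fun x hx => ?_
          have h1 : ψ (x - α) = 1 := hone _ ⟨by linarith [hx.1], by linarith [hx.2]⟩
          simp only [hy, h1, one_mul]
          nlinarith [hφge x]
      _ ≤ ∫ x in Ioi (0 : ℝ), ‖y x‖ ^ 2 :=
          setIntegral_mono_set (hyL.integrable_norm_pow two_ne_zero).integrableOn
            (Eventually.of_forall fun x => by positivity) hsub.eventuallyLE
  · have h1 := hupper y (16 / 9) (by norm_num) fun x => by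
      by_cases hx : x ∈ S
      · have h2 := hyle x
        have : 1 ≤ k x := by
          simp only [hkdef, he1 x hx, norm_one]
          linarith [norm_nonneg (p x), sq_nonneg ‖p x‖]
        rw [he1 x hx, norm_one] at h2
        nlinarith [norm_nonneg (y x)]
      · simp only [hy, hzero x hx, zero_mul, norm_zero]
        nlinarith [hk0 x]
    rw [← L2.norm_sq_toLp hyR] at h1
    nlinarith [norm_nonneg (hyR.toLp y)]
  -- This yields `‖g‖² ≤ 8D² ≤ (3D)²`, whence the constant `3 * D`.
  · have h1 := hupper G (32 * D ^ 2) (by positivity) fun x => by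
      have h2 : (‖e x‖ + ‖p x‖) ^ 2 ≤ 2 * k x := by
        by_cases hx : x ∈ S
        · simp only [hkdef, he1 x hx, norm_one]
          nlinarith [norm_nonneg (p x), sq_nonneg ‖p x‖]
        · simp only [he0 x hx, hp0 x hx, norm_zero]
          nlinarith [hk0 x]
      calc ‖G x‖ ^ 2 ≤ (4 * D * (‖e x‖ + ‖p x‖)) ^ 2 := by gcongr; exact hGle x
        _ = 16 * D ^ 2 * (‖e x‖ + ‖p x‖) ^ 2 := by ring
        _ ≤ 16 * D ^ 2 * (2 * k x) := by gcongr
        _ = 32 * D ^ 2 * k x := by ring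
    rw [← L2.norm_sq_toLp hGR] at h1
    refine abs_le_of_sq_le_sq' (h1.trans ?_) (by positivity) |>.2
    nlinarith [sq_nonneg D]
  · filter_upwards [hyR.coeFn_toLp] with x hx hxS
    rw [hx]
    simp only [hy, hzero x hxS, zero_mul]

/-! ### From bounded oscillation to a good subinterval -/

theorem L2Loc.memLp_Ioc {s : ℝ → ℂ} (hs : L2Loc s) {x y : ℝ} (hx : 0 ≤ x) :
    MemLp s 2 (volume.restrict (Ioc x y)) := by
  rcases le_or_gt y 0 with hy | hy
  · rw [Ioc_eq_empty (by linarith), Measure.restrict_empty]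
    exact ⟨aestronglyMeasurable_zero_measure _, by simp⟩
  · exact (hs y hy).mono_measure (Measure.restrict_mono (Ioc_subset_Ioc_left hx) le_rfl)

/-- A function with bounded mean square oscillation on an interval is close in `L₂` to one of its
values. -/
theorem L2Loc.exists_integral_norm_sub_sq_le {s : ℝ → ℂ} (hs : L2Loc s) {x a B : ℝ} (hx : 0 ≤ x)
    (ha : 0 < a) (hB : ∫ ξ in x..x + a, ∫ η in x..x + a, ‖s ξ - s η‖ ^ 2 ≤ B) :
    ∃ c : ℂ, ∫ t in x..x + a, ‖s t - c‖ ^ 2 ≤ B / a := by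
  have hxa : x ≤ x + a := by linarith
  have hm : MemLp s 2 (volume.restrict (Ioc x (x + a))) := hs.memLp_Ioc hx
  have hI : Integrable (fun z : ℝ × ℝ => ‖s z.1 - s z.2‖ ^ 2)
      ((volume.restrict (Ioc x (x + a))).prod (volume.restrict (Ioc x (x + a)))) :=
    ((hm.comp_fst _).sub (hm.comp_snd _)).integrable_norm_pow two_ne_zero
  simp only [intervalIntegral.integral_of_le hxa] at hB ⊢
  -- Some inner integral is at most its average over `ξ`.
  obtain ⟨ξ, -, hξ⟩ := exists_le_setAverage (μ := volume) (s := Ioc x (x + a))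
    (by simp [ha]) (by simp) hI.integral_prod_left
  refine ⟨s ξ, ?_⟩
  simp only [setAverage_eq, measureReal_def, Real.volume_Ioc, add_sub_cancel_left,
    ENNReal.toReal_ofReal ha.le, smul_eq_mul] at hξ
  simp only [norm_sub_rev _ (s ξ)]
  refine hξ.trans ?_
  rw [div_eq_inv_mul]
  exact mul_le_mul_of_nonneg_left hB (by positivity)

/-- Pigeonhole over `n` equal pieces: the integral over the whole window is bounded in terms of `a`
and `B`, so for large `n` some piece carries at most `1/4`. The length `δ` is chosen before `s` and
`x`, which keeps later bounds uniform along the windows. -/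
theorem exists_subinterval {a B : ℝ} (ha : 0 < a) :
    ∃ δ : ℝ, 0 < δ ∧ ∀ (s : ℝ → ℂ) (x : ℝ), L2Loc s → 0 ≤ x →
      ∫ ξ in x..x + a, ∫ η in x..x + a, ‖s ξ - s η‖ ^ 2 ≤ B →
      ∃ (α : ℝ) (c : ℂ), x ≤ α ∧ α + δ ≤ x + a ∧
        ∫ t in α..α + δ, (1 + ‖s t - c‖ + ‖s t - c‖ ^ 2) ≤ 1 / 4 := by
  -- Since `t ≤ (1 + t²)/2`, the total is at most `3/2 * (a + |B| / a)`, which is below `n / 4`.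
  obtain ⟨n, hn⟩ := exists_nat_gt (6 * (a + |B| / a))
  have hn0 : (0 : ℝ) < n := lt_of_le_of_lt (by positivity) hn
  have hnN : n ≠ 0 := by rintro rfl; simp at hn0
  refine ⟨a / n, by positivity, fun s x hs hx hB => ?_⟩
  obtain ⟨c, hc⟩ := hs.exists_integral_norm_sub_sq_le hx ha (hB.trans (le_abs_self B))
  have hdn : a / n * n = a := by field_simp
  have hδ : 0 < a / n := by positivity
  set δ := a / n with hδdef
  set m : ℝ → ℝ := fun t => 1 + ‖s t - c‖ + ‖s t - c‖ ^ 2 with hm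
  have hσ : MemLp (fun t => s t - c) 2 (volume.restrict (Ioc x (x + a))) :=
    (hs.memLp_Ioc hx).sub (memLp_const c)
  have h2 : IntervalIntegrable (fun t => ‖s t - c‖ ^ 2) volume x (x + a) :=
    (intervalIntegrable_iff_integrableOn_Ioc_of_le (by linarith)).2
      (hσ.integrable_norm_pow two_ne_zero)
  have h1 : IntervalIntegrable (fun t => ‖s t - c‖) volume x (x + a) :=
    (intervalIntegrable_iff_integrableOn_Ioc_of_le (by linarith)).2
      (hσ.integrable (by norm_num)).norm
  have hmI : IntervalIntegrable m volume x (x + a) :=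
    ((intervalIntegrable_const).add h1).add h2
  have htot : ∫ t in x..x + a, m t ≤ 3 / 2 * (a + |B| / a) :=
    calc ∫ t in x..x + a, m t ≤ ∫ t in x..x + a, (3 / 2 + 3 / 2 * ‖s t - c‖ ^ 2) := by
          refine intervalIntegral.integral_mono_on (by linarith) hmI
            (intervalIntegrable_const.add (h2.const_mul _)) fun t _ => ?_
          simp only [hm]
          nlinarith [sq_nonneg (‖s t - c‖ - 1)]
      _ = 3 / 2 * a + 3 / 2 * ∫ t in x..x + a, ‖s t - c‖ ^ 2 := by
          rw [intervalIntegral.integral_add intervalIntegrable_const (h2.const_mul _),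
            intervalIntegral.integral_const_mul, intervalIntegral.integral_const]
          simp only [add_sub_cancel_left, smul_eq_mul]
          ring
      _ ≤ 3 / 2 * (a + |B| / a) := by linarith
  have hpt : ∀ i : ℕ, i ≤ n → x + i * δ ∈ uIcc x (x + a) := fun i hi => by
    rw [uIcc_of_le (by linarith)]
    have h3 : (i : ℝ) ≤ n := by exact_mod_cast hi
    have h4 : (0 : ℝ) ≤ i := i.cast_nonneg
    constructor <;> nlinarith
  have hsum : ∑ i ∈ Finset.range n, ∫ t in x + (i : ℕ) * δ..x + ((i + 1 : ℕ) : ℝ) * δ, m t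
      = ∫ t in x..x + a, m t := by
    rw [intervalIntegral.sum_integral_adjacent_intervals (a := fun i : ℕ => x + i * δ)]
    · rw [mul_comm (n : ℝ), hdn]
      simp
    · intro i hi
      exact hmI.mono_set (uIcc_subset_uIcc (hpt i hi.le) (hpt (i + 1) hi))
  obtain ⟨i, hi, hile⟩ := Finset.exists_le_of_sum_le (s := Finset.range n)
    (f := fun i : ℕ => ∫ t in x + i * δ..x + ((i + 1 : ℕ) : ℝ) * δ, m t) (g := fun _ => 1 / 4)
    (Finset.nonempty_range_iff.2 hnN) (by
      rw [hsum, Finset.sum_const, Finset.card_range, nsmul_eq_mul]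
      linarith)
  have hi' : i + 1 ≤ n := Finset.mem_range.1 hi
  have h5 : x + ((i + 1 : ℕ) : ℝ) * δ = x + i * δ + δ := by push_cast; ring
  have h6 := hpt (i + 1) hi'
  rw [uIcc_of_le (by linarith), h5] at h6
  rw [h5] at hile
  exact ⟨x + i * δ, c, le_add_of_nonneg_right (by positivity), h6.2, hile⟩

/-! ### Compactness and the contradiction -/

/-- A compact operator maps no bounded sequence to a uniformly separated one. -/
theorem _root_.IsCompactOperator.not_separated {𝕜 E F : Type*} [NontriviallyNormedField 𝕜]
    [SeminormedAddCommGroup E] [NormedSpace 𝕜 E] [NormedAddCommGroup F] [NormedSpace 𝕜 F]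
    {R : E →L[𝕜] F} (hR : IsCompactOperator R) {h : ℕ → E} {C r : ℝ} (hr : 0 < r)
    (hC : ∀ n, ‖h n‖ ≤ C) (hsep : ∀ m n, m < n → r ≤ ‖R (h n) - R (h m)‖) : False := by
  obtain ⟨K, hK, hsub⟩ := IsCompactOperator.image_closedBall_subset_compact
    (f := (R : E →ₗ[𝕜] F)) hR C
  obtain ⟨l, -, φ, hφ, hlim⟩ := hK.tendsto_subseq (x := fun n => R (h n)) fun n =>
    hsub ⟨h n, by simpa using hC n, rfl⟩
  obtain ⟨N, hN⟩ := Metric.cauchySeq_iff.1 hlim.cauchySeq r hr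
  have h1 := hN (N + 1) (Nat.le_succ N) N le_rfl
  rw [dist_eq_norm] at h1
  exact absurd h1 (not_lt.2 (hsep _ _ (hφ (Nat.lt_succ_self N))))

theorem L2.norm_sub_sq_of_disjoint {f g : L2} {S T : Set ℝ} (hST : Disjoint S T)
    (hf : ∀ᵐ x ∂volume.restrict (Ioi (0 : ℝ)), x ∉ S → f x = 0)
    (hg : ∀ᵐ x ∂volume.restrict (Ioi (0 : ℝ)), x ∉ T → g x = 0) :
    ‖f - g‖ ^ 2 = ‖f‖ ^ 2 + ‖g‖ ^ 2 := by
  have h0 : inner ℂ f g = 0 := by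
    rw [MeasureTheory.L2.inner_def, integral_eq_zero_of_ae]
    filter_upwards [hf, hg] with x h1 h2
    by_cases hx : x ∈ S
    · simp [h2 (Set.disjoint_left.1 hST hx)]
    · simp [h1 hx]
  rw [@norm_sub_sq ℂ, h0]
  simp

theorem IsResolventAt.apply_of_mem_graph {A : L2 →ₗ.[ℂ] L2} {z : ℂ} {R : L2 →L[ℂ] L2}
    (hR : IsResolventAt A z R) {f g : L2} (h : (f, g) ∈ A.graph) : R (g - z • f) = f := by
  obtain ⟨x, rfl, rfl⟩ := (LinearPMap.mem_graph_iff A).1 h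
  exact hR.2 x

end SturmLiouville

theorem theorem1 (s : ℝ → ℂ) (hs : SturmLiouville.L2Loc s)
    (h : ∃ L : SturmLiouville.L2 →ₗ.[ℂ] SturmLiouville.L2,
      SturmLiouville.minimalOperator s ≤ L ∧ SturmLiouville.HasCompactResolvent L) :
    ∀ a : ℝ, 0 < a →
      Tendsto (fun x : ℝ => ∫ ξ in x..x + a, ∫ η in x..x + a, ‖s ξ - s η‖ ^ 2) atTop atTop := by
  intro a ha
  obtain ⟨L, hL, z, R, hR, hRc⟩ := h
  rw [tendsto_atTop]
  intro B
  by_contra hB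
  obtain ⟨δ, hδ, hsub⟩ := SturmLiouville.exists_subinterval (B := B) ha
  obtain ⟨C, hC⟩ := SturmLiouville.exists_minimalPair hδ
  -- Beyond any `X` there is a test function `f`, with `h = (L - z)f`; `Y` marks the end of its
  -- support, where the next search starts.
  have key : ∀ X : ℝ, ∃ (Y : ℝ) (f h : SturmLiouville.L2), X ≤ Y ∧ R h = f ∧ ‖h‖ ≤ C + ‖z‖ ∧
      2 * δ / 9 ≤ ‖f‖ ^ 2 ∧
      ∀ᵐ x ∂volume.restrict (Ioi (0 : ℝ)), x ∉ Ioc X Y → f x = 0 := by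
    intro X
    obtain ⟨x, hx, hxB⟩ := (frequently_atTop.1 (not_eventually.1 hB)) (max X 0)
    obtain ⟨α, c, hxα, hαx, hm⟩ := hsub s x hs ((le_max_right _ _).trans hx) (not_le.1 hxB).le
    have hX : X ≤ α := (le_max_left _ _).trans (hx.trans hxα)
    obtain ⟨f, g, hfg, hf, hf1, hg, hsupp⟩ :=
      hC s α c hs (((le_max_right _ _).trans hx).trans hxα) hm
    have hgr : (f, g) ∈ L.graph := LinearPMap.le_graph_of_le hL
      ((SturmLiouville.mem_graph_minimalOperator s f g).2 hfg)
    refine ⟨α + δ, f, g - z • f, by linarith, hR.apply_of_mem_graph hgr, ?_, hf, ?_⟩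
    · calc ‖g - z • f‖ ≤ ‖g‖ + ‖z‖ * ‖f‖ := (norm_sub_le _ _).trans_eq (by rw [norm_smul])
        _ ≤ C + ‖z‖ * 1 := by gcongr
        _ = C + ‖z‖ := by rw [mul_one]
    · filter_upwards [hsupp] with t ht htS
      exact ht fun h => htS (Ioc_subset_Ioc_left hX h)
  choose Y f h hXY hRf hh hf hsupp using key
  let X : ℕ → ℝ := fun n => Y^[n] 0
  have hX : ∀ n, X (n + 1) = Y (X n) := fun n => Function.iterate_succ_apply' Y n 0
  have hmono : Monotone X := monotone_nat_of_le_succ fun n => by rw [hX]; exact hXY _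
  -- Supports lie in the disjoint intervals `(X n, X (n + 1)]`, so by Pythagoras the squared
  -- distance of two images is at least `2δ/9`.
  refine hRc.not_separated (h := fun n => h (X n)) (r := Real.sqrt (2 * δ / 9)) (by positivity)
    (fun n => hh _) fun m n hmn => ?_
  have hdisj : Disjoint (Ioc (X n) (Y (X n))) (Ioc (X m) (Y (X m))) := by
    rw [← hX, ← hX]
    exact hmono.pairwise_disjoint_on_Ioc_succ hmn.ne'
  rw [hRf, hRf]
  refine Real.sqrt_le_iff.2 ⟨norm_nonneg _, ?_⟩
  rw [SturmLiouville.L2.norm_sub_sq_of_disjoint hdisj (hsupp _) (hsupp _)]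
  linarith [hf (X n), sq_nonneg ‖f (X m)‖]
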